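/- Let $m\ge 1$ be an integer and $c>0$ a real number. Let $T_n$ be the type II polynomials, given by $T_{-m}=\dots=T_{-1}=0$, $T_0=1$ and $$T_{n+1}(x)=x\,T_n(x)-c\,T_{n-m}(x),\qquad n\ge 0,$$ and let $\mathbf t_r=(t_{0,r},\dots,t_{m-1,r})$ be the type I Chebyshev polynomial vectors, given by $\mathbf t_{-1}=(0,\dots,0)$, $\mathbf t_0=(1,0,\dots,0),\ \dots,\ \mathbf t_{m-1}=(0,\dots,0,1)$ and $$c\,\mathbf t_n(x)=x\,\mathbf t_{n-m}(x)-\mathbf t_{n-m-1}(x),\qquad n\ge m .$$ Put $a=\frac{m+1}{m}\,(mc)^{1/(m+1)}$ and $S_0=\bigcup_{k=0}^{m}\left[0,\ a\,e^{2\pi i k/(m+1)}\right]\subset\mathbb C$, and let $|dx|$ denote arc length on $S_0$. A system of weights consists of a real function $\rho$ and complex functions $\rho_0\equiv 1,\rho_1,\dots,\rho_{m-1}$ on $S_0$ such that, for every $j\in\{0,\dots,m-1\}$: - $\rho_j\rho$ is integrable on $S_0$ with respect to $|dx|$; - for $0<t\le a$ and $k\in\{0,\dots,m\}$, the point $x_k=t\,e^{2\pi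 i k/(m+1)}$ satisfies $\rho_j(x_k)\rho(x_k)=e^{-2\pi i jk/(m+1)}\rho_j(t)\rho(t)$; - on $(0,a]$ the function $\rho_j\rho$ is real-valued and does not change sign; - $\int_{S_0}x^{\nu}\,T_n(x)\,\rho_j(x)\rho(x)\,|dx|=0$ for all integers $n,\nu\ge 0$ with $\nu m\le n-j-1$; - $\int_{S_0}x^{j}\rho_j(x)\rho(x)\,|dx|=1$. For a system of weights, put $\mathcal L_r(x)=\sum_{j=0}^{m-1}t_{j,r}(x)\,\rho_j(x)$. Then a system of weights exists, and for every system of weights and all integers $n,r\ge 0$ the function $T_n\mathcal L_r\,\rho$ is integrable on $S_0$ and $$\int_{S_0}T_n(x)\,\mathcal L_r(x)\,\rho(x)\,|dx|=\delta_{n,r}.$$ -/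

import Mathlib

open Polynomial MeasureTheory

noncomputable section

namespace StarChebyshev

/-- The type II polynomials: `T 0 = 1` and `T (n+1) = x T n - c T (n-m)`,
where the polynomials with a negative index are zero. -/
def typeII (m : ℕ) (c : ℝ) : ℕ → ℂ[X]
  | 0 => 1
  | n + 1 => X * typeII m c n - (if m ≤ n then C (c : ℂ) * typeII m c (n - m) else 0)
  decreasing_by all_goals omega

/-- The component with index `j` (where `0 ≤ j < m`) of the type I Chebyshev polynomial vectors.
The first `m` vectors are the standard unit vectors, the vector with index `-1` is zero, and
`c t n = x t (n-m) - t (n-m-1)` for `n ≥ m`. Only `0 < m` matters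
(for `m = 0` there are no components). -/
def typeI (m : ℕ) (c : ℝ) (j : ℕ) (n : ℕ) : ℂ[X] :=
  if h : n < m ∨ m = 0 then (if n = j then 1 else 0)
  else C ((c : ℂ)⁻¹) *
    (X * typeI m c j (n - m) - (if m + 1 ≤ n then typeI m c j (n - m - 1) else 0))
  termination_by n
  decreasing_by all_goals omega

theorem typeII_zero (m : ℕ) (c : ℝ) : typeII m c 0 = 1 := by
  rw [typeII]

theorem typeII_succ_of_lt {m n : ℕ} (c : ℝ) (h : n < m) :
    typeII m c (n + 1) = X * typeII m c n := by
  rw [typeII, if_neg (by omega), sub_zero]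

theorem typeII_succ_of_le {m n : ℕ} (c : ℝ) (h : m ≤ n) :
    typeII m c (n + 1) = X * typeII m c n - C (c : ℂ) * typeII m c (n - m) := by
  rw [typeII, if_pos h]

theorem typeI_of_lt {m n : ℕ} (c : ℝ) (j : ℕ) (h : n < m) :
    typeI m c j n = if n = j then 1 else 0 := by
  rw [typeI, dif_pos (Or.inl h)]

theorem typeI_self {m : ℕ} {c : ℝ} (hm : 0 < m) (hc : c ≠ 0) (j : ℕ) :
    C (c : ℂ) * typeI m c j m = X * typeI m c j 0 := by
  have hc' : (c : ℂ) ≠ 0 := by exact_mod_cast hc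
  rw [typeI, dif_neg (by omega), if_neg (by omega), ← mul_assoc, ← C_mul, mul_inv_cancel₀ hc']
  simp

theorem typeI_of_gt {m n : ℕ} {c : ℝ} (hm : 0 < m) (hc : c ≠ 0) (j : ℕ) (h : m < n) :
    C (c : ℂ) * typeI m c j n = X * typeI m c j (n - m) - typeI m c j (n - m - 1) := by
  have hc' : (c : ℂ) ≠ 0 := by exact_mod_cast hc
  rw [typeI, dif_neg (by omega), if_pos (by omega), ← mul_assoc, ← C_mul, mul_inv_cancel₀ hc']
  simp

/-- The length `((m+1)/m) (mc)^(1/(m+1))` of the rays of the star. -/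
def radius (m : ℕ) (c : ℝ) : ℝ :=
  ((m : ℝ) + 1) / m * ((m : ℝ) * c) ^ ((1 : ℝ) / ((m : ℝ) + 1))

/-- The point `t exp(2πik/(m+1))` of the ray with index `k`. -/
def rayPoint (m k : ℕ) (t : ℝ) : ℂ :=
  (t : ℂ) * Complex.exp (2 * Real.pi * Complex.I * k / (m + 1))

/-- The starlike set: the union of the `m+1` segments that join the origin with the points
`radius m c * exp(2πik/(m+1))`, for `k = 0, ..., m`. -/
def starSet (m : ℕ) (c : ℝ) : Set ℂ :=
  ⋃ k : Fin (m + 1), segment ℝ (0 : ℂ) (rayPoint m k (radius m c))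

/-- Arc length on the star: the sum of the Lebesgue measures of its `m+1` rays. -/
def arcLength (m : ℕ) (c : ℝ) : Measure ℂ :=
  ∑ k : Fin (m + 1), Measure.map (rayPoint m k) (volume.restrict (Set.Icc 0 (radius m c)))

/-- A real-valued function of constant sign on `D`. -/
def IsWeightOn (f : ℝ → ℂ) (D : Set ℝ) : Prop :=
  (∀ t ∈ D, (f t).im = 0) ∧ ((∀ t ∈ D, 0 ≤ (f t).re) ∨ (∀ t ∈ D, (f t).re ≤ 0))

/-- The functions `ρ` and `ρ_0 = 1, ρ_1, ..., ρ_{m-1}` on the star form a system of weights of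
the type II polynomials: with `dσ_j = ρ_j ρ |dx|`, the products `ρ_j ρ` are integrable, have the
rotational symmetry of the star, and are of constant sign on the ray of positive reals; the type II
polynomials are multi-orthogonal with respect to `σ_0, ..., σ_{m-1}`; and `σ_j` is normalized so
that its moment of order `j`, which is its first moment that does not vanish by symmetry,
is equal to one. -/
structure IsWeightSystem (m : ℕ) (c : ℝ) (ρ : ℂ → ℝ) (ρs : ℕ → ℂ → ℂ) : Prop where
  first : ∀ x ∈ starSet m c, ρs 0 x = 1
  integrable : ∀ j < m, Integrable (fun x => ρs j x * ρ x) (arcLength m c)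
  symmetry : ∀ j < m, ∀ k ≤ m, ∀ t ∈ Set.Ioc 0 (radius m c),
    ρs j (rayPoint m k t) * ρ (rayPoint m k t) =
      Complex.exp (-(2 * Real.pi * Complex.I * j * k / (m + 1))) * (ρs j t * ρ t)
  weight : ∀ j < m, IsWeightOn (fun t => ρs j t * ρ t) (Set.Ioc 0 (radius m c))
  /-- Orthogonality for `ν = 0, ..., d`, where `d` is the integer part of `(n-j-1)/m`. -/
  orthogonality : ∀ n : ℕ, ∀ j < m, ∀ ν : ℕ, ν * m + j + 1 ≤ n →
    ∫ x, x ^ ν * (typeII m c n).eval x * (ρs j x * ρ x) ∂(arcLength m c) = 0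
  normalization : ∀ j < m, ∫ x, x ^ j * (ρs j x * ρ x) ∂(arcLength m c) = 1

/-- The linear form `L_r(x) = ∑ t_{j,r}(x) ρ_j(x)`, with `j` from `0` to `m-1`. -/
def linearForm (m : ℕ) (c : ℝ) (ρs : ℕ → ℂ → ℂ) (r : ℕ) (x : ℂ) : ℂ :=
  ∑ j ∈ Finset.range m, (typeI m c j r).eval x * ρs j x

end StarChebyshev

end

namespace StarChebyshev

/-! Biorthogonality is algebraic. Integration against `ρ_j ρ` is a functional with value `δ_{n,j}`
at `T_n` (`IsWeightSystem.integral_typeII`). Multiplication by `x` acts on the `T_n` by `x T_n =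
T_{n+1} + c T_{n-m}`, and the type I recurrence is its transpose, so induction on `r` gives the
result (`sum_typeII_mul_typeI`).

Existence means realizing these dual functionals by densities. The coefficient of `T_j` in `x^N`
vanishes unless `N = j + (m+1)k`, and then it is a power of `c` times a Raney number
(`pathWeight_eq`). Rotational symmetry kills the same moments, which leaves a moment problem on one
ray. After scaling by the radius, the quotient of consecutive moments splits into `m` factors, each
the moment quotient of a beta-type density `t^q (1-t^(m+1))^(v-1)` on `(0,1)`
(`exists_unit_density`). Multiplicative convolution multiplies moments and preserves equivalence to
Lebesgue measure (`IsEquivUnitInterval.exists_mul`), so a positive density exists; positivity allows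
`ρ_j` to be a quotient of two densities. -/

/-! ### Powers of `x` in the basis of type II polynomials -/

/-- The coefficient of `T_j` in the expansion of `x^N`: the weighted number of lattice paths from
`0` to `j` with `N` steps `+1` (weight one) or `-m` (weight `c`) that stay nonnegative. -/
noncomputable def pathWeight (m : ℕ) (c : ℝ) : ℕ → ℕ → ℝ
  | 0, j => if j = 0 then 1 else 0
  | N + 1, 0 => c * pathWeight m c N m
  | N + 1, j + 1 => pathWeight m c N j + c * pathWeight m c N (j + 1 + m)

theorem pathWeight_eq_zero (m : ℕ) (c : ℝ) (N j : ℕ) (h : ∀ k, N ≠ j + (m + 1) * k) :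
    pathWeight m c N j = 0 := by
  induction N generalizing j with
  | zero =>
    have : j ≠ 0 := fun hj => h 0 (by simp [hj])
    simp [pathWeight, this]
  | succ N ih =>
    cases j with
    | zero =>
      rw [pathWeight, ih m fun k hk => h (k + 1) (by rw [hk]; ring), mul_zero]
    | succ j =>
      rw [pathWeight, ih j fun k hk => h k (by rw [hk]; ring),
        ih (j + 1 + m) fun k hk => h (k + 1) (by rw [hk]; ring), mul_zero, add_zero]

/-- The Raney numbers. -/
theorem pathWeight_eq (m : ℕ) (c : ℝ) (N j k : ℕ) (h : N = j + (m + 1) * k) :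
    pathWeight m c N j =
      c ^ k * (j + 1) * N.factorial / (k.factorial * (m * k + j + 1).factorial) := by
  induction N generalizing j k with
  | zero =>
    obtain rfl : j = 0 := by omega
    obtain rfl : k = 0 := by
      rcases Nat.eq_zero_or_pos k with hk | hk
      · exact hk
      · have := Nat.mul_pos (Nat.succ_pos m) hk
        simp at h
        omega
    simp [pathWeight]
  | succ N ih =>
    cases j with
    | zero =>
      cases k with
      | zero => simp at h
      | succ k =>
        have hN : N = m + (m + 1) * k := by
          have : (m + 1) * (k + 1) = (m + 1) * k + m + 1 := by ring
          omega
        rw [pathWeight, ih m k hN, Nat.factorial_succ N, Nat.factorial_succ k,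
          show m * (k + 1) + 0 + 1 = m * k + m + 1 by ring]
        have hN' : (N : ℝ) = m + (m + 1) * k := by exact_mod_cast hN
        have := Nat.factorial_pos k
        have := Nat.factorial_pos (m * k + m + 1)
        push_cast
        rw [hN']
        field_simp
        ring
    | succ j =>
      cases k with
      | zero =>
        obtain rfl : N = j := by simpa using h
        rw [pathWeight, ih N 0 (by simp), pathWeight_eq_zero m c N (N + 1 + m) (by intro k; omega)]
        have := Nat.factorial_pos N
        simp only [Nat.mul_zero, zero_add, Nat.factorial_succ, Nat.factorial_zero]
        push_cast
        field_simp
        ring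
      | succ k =>
        have hN : N = j + (m + 1) * (k + 1) := by omega
        have hN' : N = (j + 1 + m) + (m + 1) * k := by rw [hN]; ring
        rw [pathWeight, ih j _ hN, ih _ k hN', Nat.factorial_succ N, Nat.factorial_succ k,
          show m * k + (j + 1 + m) + 1 = (m * (k + 1) + j + 1) + 1 by ring,
          show m * (k + 1) + (j + 1) + 1 = (m * (k + 1) + j + 1) + 1 by ring,
          Nat.factorial_succ (m * (k + 1) + j + 1)]
        have hNr : (N : ℝ) = j + (m + 1) * (k + 1) := by exact_mod_cast hN
        have := Nat.factorial_pos k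
        have := Nat.factorial_pos (m * (k + 1) + j + 1)
        generalize (m * (k + 1) + j + 1).factorial = D at *
        push_cast
        rw [hNr]
        field_simp
        ring

/-! ### Dual functionals and algebraic biorthogonality -/

/-- The linear functional that maps a polynomial to the coefficient of `T_j` in its expansion. -/
noncomputable def coeffFunctional (m : ℕ) (c : ℝ) (j : ℕ) : ℂ[X] →ₗ[ℂ] ℂ :=
  Polynomial.lsum fun N => (pathWeight m c N j : ℂ) • LinearMap.id

theorem coeffFunctional_monomial (m : ℕ) (c : ℝ) (j N : ℕ) (b : ℂ) :
    coeffFunctional m c j (monomial N b) = b * pathWeight m c N j := by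
  simp [coeffFunctional, Polynomial.lsum_apply, sum_monomial_index, mul_comm]

theorem coeffFunctional_X_mul_zero (m : ℕ) (c : ℝ) (P : ℂ[X]) :
    coeffFunctional m c 0 (X * P) = c * coeffFunctional m c m P := by
  induction P using Polynomial.induction_on' with
  | add P Q hP hQ => rw [mul_add, map_add, map_add, hP, hQ]; ring
  | monomial N b =>
    rw [X_mul_monomial, coeffFunctional_monomial, coeffFunctional_monomial, pathWeight]
    push_cast
    ring

theorem coeffFunctional_X_mul_succ (m : ℕ) (c : ℝ) (j : ℕ) (P : ℂ[X]) :
    coeffFunctional m c (j + 1) (X * P) =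
      coeffFunctional m c j P + c * coeffFunctional m c (j + 1 + m) P := by
  induction P using Polynomial.induction_on' with
  | add P Q hP hQ => simp only [mul_add, map_add, hP, hQ]; ring
  | monomial N b =>
    rw [X_mul_monomial]
    simp only [coeffFunctional_monomial, pathWeight]
    push_cast
    ring

theorem coeffFunctional_typeII (m : ℕ) (c : ℝ) (n j : ℕ) :
    coeffFunctional m c j (typeII m c n) = if n = j then 1 else 0 := by
  induction n using Nat.strong_induction_on generalizing j with
  | _ n ih =>
    cases n with
    | zero =>
      rw [typeII_zero, ← monomial_zero_one, coeffFunctional_monomial, pathWeight]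
      split_ifs <;> first | omega | simp
    | succ n =>
      have ih' := ih n (by omega)
      have hX : coeffFunctional m c j (X * typeII m c n) =
          (if n + 1 = j then 1 else 0) + c * (if n = j + m then 1 else 0) := by
        cases j with
        | zero => rw [coeffFunctional_X_mul_zero, ih', if_neg (Nat.succ_ne_zero n)]; simp
        | succ j => rw [coeffFunctional_X_mul_succ, ih', ih']; simp
      rcases lt_or_ge n m with h | h
      · rw [typeII_succ_of_lt c h, hX, if_neg (show n ≠ j + m by omega)]
        simp
      · rw [typeII_succ_of_le c h, map_sub, hX, ← smul_eq_C_mul, map_smul, smul_eq_mul,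
          ih (n - m) (by omega)]
        have : n = j + m ↔ n - m = j := by omega
        simp only [this, add_sub_cancel_right]

/-- Moving one factor `x` onto the functional replaces the index `j` by `j-1` and `j+m`. The index
grows by at most `m` per factor, so it never reaches `n`. -/
theorem coeffFunctional_X_pow_mul_typeII (m : ℕ) (c : ℝ) (n j ν : ℕ) (h : ν * m + j + 1 ≤ n) :
    coeffFunctional m c j (X ^ ν * typeII m c n) = 0 := by
  induction ν generalizing j with
  | zero => rw [pow_zero, one_mul, coeffFunctional_typeII, if_neg (by omega)]
  | succ ν ih =>
    rw [Nat.succ_mul] at h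
    rw [pow_succ', mul_assoc]
    cases j with
    | zero => rw [coeffFunctional_X_mul_zero, ih m (by omega), mul_zero]
    | succ j =>
      rw [coeffFunctional_X_mul_succ, ih j (by omega), ih (j + 1 + m) (by omega)]
      simp

/-- Linear functionals that are dual to `T_0, ..., T_{m-1}` and vanish on the other type II
polynomials make the type I vectors biorthogonal to the type II polynomials. -/
theorem sum_typeII_mul_typeI {m : ℕ} (hm : 0 < m) {c : ℝ} (hc : c ≠ 0) (I : ℕ → ℂ[X] →ₗ[ℂ] ℂ)
    (hI : ∀ j < m, ∀ n, I j (typeII m c n) = if n = j then 1 else 0) (n r : ℕ) :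
    ∑ j ∈ Finset.range m, I j (typeII m c n * typeI m c j r) = if n = r then 1 else 0 := by
  have hc' : (c : ℂ) ≠ 0 := by exact_mod_cast hc
  induction r using Nat.strong_induction_on generalizing n with
  | _ r ih =>
    rcases lt_or_ge r m with h | h
    · rw [Finset.sum_eq_single_of_mem r (Finset.mem_range.2 h)]
      · rw [typeI_of_lt c r h, if_pos rfl, mul_one, hI r h]
      · intro j _ hj
        rw [typeI_of_lt c j h, if_neg hj.symm, mul_zero, map_zero]
    -- The factor `x` is moved from the type I to the type II side; the induction hypothesis at `r -
    -- m` then evaluates both terms of `x T_n`.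
    · have hX : ∑ j ∈ Finset.range m, I j (typeII m c n * (X * typeI m c j (r - m))) =
          (if n + 1 + m = r then 1 else 0) + c * (if n = r then 1 else 0) := by
        have h1 := ih (r - m) (by omega) (n + 1)
        rcases lt_or_ge n m with hn | hn
        · rw [typeII_succ_of_lt c hn] at h1
          rw [if_neg (show n ≠ r by omega), mul_zero, add_zero]
          have : n + 1 + m = r ↔ n + 1 = r - m := by omega
          simp only [this, ← h1]
          refine Finset.sum_congr rfl fun j _ => ?_
          congr 1
          ring
        · have h2 := ih (r - m) (by omega) (n - m)
          rw [typeII_succ_of_le c hn] at h1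
          have e1 : n + 1 + m = r ↔ n + 1 = r - m := by omega
          have e2 : n = r ↔ n - m = r - m := by omega
          simp only [e1, e2, ← h1, ← h2, Finset.mul_sum]
          rw [← Finset.sum_add_distrib]
          refine Finset.sum_congr rfl fun j _ => ?_
          rw [← smul_eq_mul (c : ℂ), ← map_smul, ← map_add, smul_eq_C_mul]
          congr 1
          ring
      refine mul_left_cancel₀ hc' ?_
      rw [Finset.mul_sum]
      have hterm : ∀ j, (c : ℂ) * I j (typeII m c n * typeI m c j r) =
          I j (typeII m c n * (C (c : ℂ) * typeI m c j r)) := fun j => by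
        rw [← smul_eq_mul (c : ℂ), ← map_smul, smul_eq_C_mul]
        congr 1
        ring
      simp only [hterm]
      -- The term `t_{r-m-1}` cancels the first delta of `hX`. For `r = m` it is `t_{-1} = 0`, and
      -- that delta is zero as well.
      rcases h.eq_or_lt with rfl | h
      · rw [← add_zero ((c : ℂ) * _)]
        simp only [typeI_self hm hc, Nat.sub_self] at hX ⊢
        rw [hX, if_neg (by omega)]
        ring
      · simp only [typeI_of_gt hm hc _ h, mul_sub, map_sub, Finset.sum_sub_distrib, hX]
        rw [ih (r - m - 1) (by omega)]
        have : n + 1 + m = r ↔ n = r - m - 1 := by omega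
        simp only [this]
        ring

/-! ### Beta-type densities on the unit interval -/

-- Since `t^p ≤ t`, a singularity at `1` (when `v < 1`) is no worse than that of `(1-t)^(v-1)`.
open Set in
theorem integrableOn_pow_mul_one_sub_pow_rpow {p : ℕ} (hp : p ≠ 0) {v : ℝ} (hv : 0 < v) (n : ℕ) :
    IntegrableOn (fun t : ℝ => t ^ n * (1 - t ^ p) ^ (v - 1)) (Ioo 0 1) := by
  have h1 : IntegrableOn (fun t : ℝ => 1 + (1 - t) ^ (v - 1)) (Ioo 0 1) := by
    have h := (intervalIntegral.intervalIntegrable_rpow' (a := 0) (b := 1)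
      (show -1 < v - 1 by linarith)).comp_sub_left 1
    simp only [sub_zero, sub_self] at h
    have h' := (intervalIntegrable_iff_integrableOn_Ioo_of_le zero_le_one).1 h.symm
    exact (integrableOn_const (by simp)).add h'
  refine h1.mono' (by fun_prop) ?_
  filter_upwards [ae_restrict_mem measurableSet_Ioo] with t ht
  have htp : t ^ p ≤ t := pow_le_of_le_one ht.1.le ht.2.le hp
  have htp0 : 0 ≤ t ^ p := pow_nonneg ht.1.le p
  have hn0 : 0 ≤ t ^ n := pow_nonneg ht.1.le n
  have hn : t ^ n ≤ 1 := pow_le_one₀ ht.1.le ht.2.le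
  have hpos : 0 < 1 - t := sub_pos.2 ht.2
  have hr0 : 0 ≤ (1 - t ^ p) ^ (v - 1) := Real.rpow_nonneg (by linarith) _
  rw [Real.norm_of_nonneg (mul_nonneg hn0 hr0)]
  have hr : (1 - t ^ p) ^ (v - 1) ≤ 1 + (1 - t) ^ (v - 1) := by
    have h0 : 0 ≤ (1 - t) ^ (v - 1) := Real.rpow_nonneg hpos.le _
    rcases le_total 1 v with h | h
    · have := Real.rpow_le_one (x := 1 - t ^ p) (z := v - 1) (by linarith) (by linarith)
        (by linarith)
      linarith
    · have := Real.rpow_le_rpow_of_nonpos hpos (show 1 - t ≤ 1 - t ^ p by linarith)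
        (show v - 1 ≤ 0 by linarith)
      linarith
  calc t ^ n * (1 - t ^ p) ^ (v - 1) ≤ 1 * (1 - t ^ p) ^ (v - 1) := by gcongr
    _ ≤ _ := by rwa [one_mul]

-- The function `t^(n+1) (1-t^p)^v` vanishes at both endpoints, so its derivative has integral zero.
open Set in
theorem integral_pow_mul_one_sub_pow_rpow {p : ℕ} (hp : p ≠ 0) {v : ℝ} (hv : 0 < v) (n : ℕ) :
    (n + 1) * ∫ t in Ioo (0 : ℝ) 1, t ^ n * (1 - t ^ p) ^ (v - 1) =
      (n + 1 + p * v) * ∫ t in Ioo (0 : ℝ) 1, t ^ (n + p) * (1 - t ^ p) ^ (v - 1) := by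
  have i1 := integrableOn_pow_mul_one_sub_pow_rpow hp hv n
  have i2 := integrableOn_pow_mul_one_sub_pow_rpow hp hv (n + p)
  have hint : IntegrableOn (fun t : ℝ => (n + 1) * (t ^ n * (1 - t ^ p) ^ (v - 1)) -
      (n + 1 + p * v) * (t ^ (n + p) * (1 - t ^ p) ^ (v - 1))) (Ioo 0 1) :=
    (i1.const_mul _).sub (i2.const_mul _)
  have key := intervalIntegral.integral_eq_sub_of_hasDerivAt_of_le (zero_le_one' ℝ)
    (f := fun t : ℝ => t ^ (n + 1) * (1 - t ^ p) ^ v) ?_ ?_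
    ((intervalIntegrable_iff_integrableOn_Ioo_of_le zero_le_one).2 hint)
  · rw [intervalIntegral.integral_of_le zero_le_one, integral_Ioc_eq_integral_Ioo,
      integral_sub (i1.const_mul _) (i2.const_mul _), integral_const_mul, integral_const_mul] at key
    simp [hv.ne'] at key
    linarith
  · refine ContinuousOn.mul (by fun_prop) (ContinuousOn.rpow_const (by fun_prop) ?_)
    exact fun _ _ => Or.inr hv.le
  · intro t ht
    have hpos : 0 < 1 - t ^ p := sub_pos.2 (pow_lt_one₀ ht.1.le ht.2 hp)
    have h := (hasDerivAt_pow (n + 1) t).mul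
      (((hasDerivAt_pow p t).const_sub 1).rpow_const (p := v) (Or.inl hpos.ne'))
    refine h.congr_deriv ?_
    have hv1 : (1 - t ^ p) ^ v = (1 - t ^ p) ^ (v - 1) * (1 - t ^ p) := by
      rw [← Real.rpow_add_one hpos.ne', sub_add_cancel]
    obtain ⟨q, rfl⟩ := Nat.exists_eq_succ_of_ne_zero hp
    rw [hv1]
    simp only [Nat.succ_eq_add_one, Nat.add_sub_cancel]
    push_cast
    ring

/-! ### Multiplicative convolution of measures -/

/-- The measure is finite and has the same null sets as Lebesgue measure on `(0,1)`. -/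
structure IsEquivUnitInterval (μ : Measure ℝ) : Prop where
  finite : IsFiniteMeasure μ
  ac : μ ≪ volume.restrict (Set.Ioo 0 1)
  ac' : volume.restrict (Set.Ioo 0 1) ≪ μ

open Set in
theorem exists_measure_pow_mul_one_sub_pow_rpow {p : ℕ} (hp : p ≠ 0) {v : ℝ} (hv : 0 < v)
    (q : ℕ) : ∃ μ : Measure ℝ, IsEquivUnitInterval μ ∧
      ∀ n : ℕ, ∫ t, t ^ n ∂μ = ∫ t in Ioo (0 : ℝ) 1, t ^ (n + q) * (1 - t ^ p) ^ (v - 1) := by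
  have hpos : ∀ᵐ t ∂(volume.restrict (Ioo (0 : ℝ) 1)), 0 < t ^ q * (1 - t ^ p) ^ (v - 1) := by
    filter_upwards [ae_restrict_mem measurableSet_Ioo] with t ht
    have h1 : 0 < 1 - t ^ p := sub_pos.2 (pow_lt_one₀ ht.1.le ht.2 hp)
    exact mul_pos (pow_pos ht.1 q) (Real.rpow_pos_of_pos h1 _)
  have hmeas : Measurable fun t : ℝ => ENNReal.ofReal (t ^ q * (1 - t ^ p) ^ (v - 1)) := by
    fun_prop
  refine ⟨(volume.restrict (Ioo 0 1)).withDensity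
    fun t => ENNReal.ofReal (t ^ q * (1 - t ^ p) ^ (v - 1)), ⟨?_, ?_, ?_⟩, fun n => ?_⟩
  · exact isFiniteMeasure_withDensity_ofReal
      (integrableOn_pow_mul_one_sub_pow_rpow hp hv q).hasFiniteIntegral
  · exact withDensity_absolutelyContinuous _ _
  · refine withDensity_absolutelyContinuous' hmeas.aemeasurable ?_
    filter_upwards [hpos] with t ht
    simpa using ht
  · rw [integral_withDensity_eq_integral_toReal_smul hmeas (by simp)]
    refine integral_congr_ae ?_
    filter_upwards [hpos] with t ht
    rw [ENNReal.toReal_ofReal ht.le, smul_eq_mul]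
    ring

theorem volume_preimage_mul_left_eq_zero {x : ℝ} (hx : x ≠ 0) {N : Set ℝ} (hN : volume N = 0) :
    volume ((fun y => x * y) ⁻¹' N) = 0 := by
  rw [Real.volume_preimage_mul_left hx, hN, mul_zero]

-- The law of the product of independent variables has the products of the moments as moments. Null
-- sets are compared fibrewise, because dilations preserve Lebesgue null sets.
open Set in
theorem IsEquivUnitInterval.exists_mul {μ ν : Measure ℝ} (hμ : IsEquivUnitInterval μ)
    (hν : IsEquivUnitInterval ν) : ∃ η : Measure ℝ, IsEquivUnitInterval η ∧
      ∀ n : ℕ, ∫ t, t ^ n ∂η = (∫ t, t ^ n ∂μ) * ∫ t, t ^ n ∂ν := by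
  have := hμ.finite
  have := hν.finite
  have hmul : Measurable fun z : ℝ × ℝ => z.1 * z.2 := by fun_prop
  have mem : ∀ {κ : Measure ℝ}, κ ≪ volume.restrict (Ioo 0 1) → ∀ᵐ x ∂κ, x ∈ Ioo (0 : ℝ) 1 :=
    fun h => h.ae_le (ae_restrict_mem measurableSet_Ioo)
  refine ⟨(μ.prod ν).map fun z => z.1 * z.2, ⟨inferInstance, ?_, ?_⟩, fun n => ?_⟩
  · refine Measure.AbsolutelyContinuous.mk fun N hN h0 => ?_
    rw [Measure.map_apply hmul hN, Measure.measure_prod_null (hmul hN)]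
    filter_upwards [mem hμ.ac] with x hx
    rw [Measure.restrict_apply hN] at h0
    have h1 := volume_preimage_mul_left_eq_zero hx.1.ne' h0
    have h2 : ν ((fun y => x * y) ⁻¹' (N ∩ Ioo 0 1)) = 0 :=
      hν.ac (Measure.restrict_le_self.absolutelyContinuous h1)
    have h3 : ∀ᵐ y ∂ν, y ∉ (fun y => x * y) ⁻¹' (N ∩ Ioo 0 1) := measure_eq_zero_iff_ae_notMem.1 h2
    refine measure_eq_zero_iff_ae_notMem.2 ?_
    filter_upwards [h3, mem hν.ac] with y hy hy1 hN'
    exact hy ⟨hN', mul_pos hx.1 hy1.1, mul_lt_one_of_nonneg_of_lt_one_left hx.1.le hx.2 hy1.2.le⟩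
  · refine Measure.AbsolutelyContinuous.mk fun N hN h0 => ?_
    rw [Measure.map_apply hmul hN, Measure.measure_prod_null (hmul hN)] at h0
    -- The fibre over `x` only sees `N` below `x`, so points `x` that tend to `1` are needed to
    -- cover `N`.
    have h1 : ∀ᵐ x ∂(volume.restrict (Ioo (0 : ℝ) 1)), volume (N ∩ Ioo 0 x) = 0 := by
      filter_upwards [hμ.ac'.ae_le h0, ae_restrict_mem measurableSet_Ioo] with x hx hx1
      have h2 : volume.restrict (Ioo 0 1) ((fun y => x * y) ⁻¹' N) = 0 := hν.ac' hx
      rw [Measure.restrict_apply (measurable_const_mul x (by exact hN))] at h2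
      have h3 := volume_preimage_mul_left_eq_zero (inv_ne_zero hx1.1.ne') h2
      refine measure_mono_null (fun y hy => ?_) h3
      have hy2 := hy.2
      refine ⟨?_, ?_, ?_⟩
      · simpa [mul_inv_cancel_left₀ hx1.1.ne'] using hy.1
      · exact mul_pos (inv_pos.2 hx1.1) hy2.1
      · rw [inv_mul_lt_one₀ hx1.1]
        exact hy2.2
    have h4 : ∀ k : ℕ, ∃ x, 1 - 1 / ((k : ℝ) + 1) < x ∧ volume (N ∩ Ioo 0 x) = 0 := by
      intro k
      have hk : 0 < 1 / ((k : ℝ) + 1) := by positivity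
      have hk1 : 1 / ((k : ℝ) + 1) ≤ 1 := by
        rw [div_le_one (by positivity)]
        linarith [k.cast_nonneg (α := ℝ)]
      have hI : volume (Ioo (1 - 1 / ((k : ℝ) + 1)) 1) ≠ 0 := by simp; positivity
      have h5 := (ae_restrict_iff' measurableSet_Ioo).1 h1
      have h6 : ∃ᶠ x in ae volume, x ∈ Ioo (1 - 1 / ((k : ℝ) + 1)) 1 :=
        frequently_ae_mem_iff.2 hI
      obtain ⟨x, hx, hx'⟩ := (h6.and_eventually h5).exists
      exact ⟨x, hx.1, hx' ⟨by linarith [hx.1], hx.2⟩⟩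
    choose x hx hx0 using h4
    rw [Measure.restrict_apply hN]
    refine measure_mono_null (fun y hy => ?_) (measure_iUnion_null hx0)
    obtain ⟨k, hk⟩ := exists_nat_one_div_lt (sub_pos.2 hy.2.2)
    exact mem_iUnion.2 ⟨k, hy.1, hy.2.1, by linarith [hx k]⟩
  · rw [integral_map hmul.aemeasurable (by fun_prop)]
    simp only [mul_pow]
    exact integral_prod_mul (fun x : ℝ => x ^ n) fun y : ℝ => y ^ n

/-- At least one factor is needed: the empty product has the moments of a point mass at `1`. -/
theorem exists_measure_prod_moments (n : ℕ) (μ : Fin (n + 1) → Measure ℝ)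
    (hμ : ∀ i, IsEquivUnitInterval (μ i)) : ∃ η : Measure ℝ, IsEquivUnitInterval η ∧
      ∀ N : ℕ, ∫ t, t ^ N ∂η = ∏ i, ∫ t, t ^ N ∂(μ i) := by
  induction n with
  | zero => exact ⟨μ 0, hμ 0, by simp⟩
  | succ n ih =>
    obtain ⟨η, hη, hm⟩ := ih (fun i => μ i.succ) fun i => hμ _
    obtain ⟨κ, hκ, hk⟩ := (hμ 0).exists_mul hη
    exact ⟨κ, hκ, fun N => by rw [Fin.prod_univ_succ, hk, hm]⟩

-- The density is the Radon–Nikodym derivative, changed to `1` on a null set so that it is positive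
-- everywhere and can later serve as a divisor.
open Set in
theorem IsEquivUnitInterval.exists_density {η : Measure ℝ} (hη : IsEquivUnitInterval η) :
    ∃ f : ℝ → ℝ, (∀ t, 0 < f t) ∧ IntegrableOn f (Ioo 0 1) ∧
      ∀ n : ℕ, ∫ t in Ioo (0 : ℝ) 1, t ^ n * f t = ∫ t, t ^ n ∂η := by
  have := hη.finite
  set g : ℝ → ℝ := fun t => (η.rnDeriv (volume.restrict (Ioo 0 1)) t).toReal with hg
  have hpos : ∀ᵐ t ∂(volume.restrict (Ioo (0 : ℝ) 1)), 0 < g t := by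
    filter_upwards [hη.ac'.ae_le (Measure.rnDeriv_pos hη.ac),
      Measure.rnDeriv_lt_top η (volume.restrict (Ioo 0 1))] with t h1 h2
    exact ENNReal.toReal_pos h1.ne' h2.ne
  have hfg : (fun t => if 0 < g t then g t else 1) =ᵐ[volume.restrict (Ioo (0 : ℝ) 1)] g := by
    filter_upwards [hpos] with t ht
    rw [if_pos ht]
  refine ⟨fun t => if 0 < g t then g t else 1, fun t => ?_, ?_, fun n => ?_⟩
  · dsimp only
    split_ifs with h
    · exact h
    · exact one_pos
  · exact Measure.integrable_toReal_rnDeriv.congr hfg.symm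
  · rw [← integral_rnDeriv_smul hη.ac]
    refine integral_congr_ae ?_
    filter_upwards [hfg] with t ht
    rw [ht, smul_eq_mul, mul_comm]

/-! ### Densities with Raney moments on one ray -/

theorem radius_pos {m : ℕ} (hm : 0 < m) {c : ℝ} (hc : 0 < c) : 0 < radius m c := by
  rw [radius]
  positivity

theorem radius_pow {m : ℕ} {c : ℝ} (hc : 0 < c) :
    radius m c ^ (m + 1) = (((m : ℝ) + 1) / m) ^ (m + 1) * (m * c) := by
  rw [radius, mul_pow, ← Real.rpow_natCast (_ ^ _), ← Real.rpow_mul (by positivity)]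
  push_cast
  rw [one_div_mul_cancel (by positivity), Real.rpow_one]

/-- The zeros `-(j+1+i)/(m+1)` and the poles `-(j+2+i)/m` of the quotient of consecutive Raney
numbers, as a function of their index, interlace. -/
theorem beta_parameter_pos {m : ℕ} (hm : 0 < m) (j : ℕ) (i₀ : Fin (m + 1)) (i : Fin m) :
    0 < ((j : ℝ) + 2 + i) / m - ((j : ℝ) + 1 + i₀.succAbove i) / (m + 1) := by
  have h1 : ((i₀.succAbove i : ℕ) : ℝ) ≤ i + 1 := by
    have : (i₀.succAbove i : ℕ) ≤ i + 1 := by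
      rw [Fin.succAbove]
      split_ifs <;> simp
    exact_mod_cast this
  have hm' : (0 : ℝ) < m := by exact_mod_cast hm
  have hj : (0 : ℝ) ≤ j := j.cast_nonneg
  have hi : (0 : ℝ) ≤ (i : ℕ) := Nat.cast_nonneg _
  rw [sub_pos, div_lt_div_iff₀ (by positivity) hm']
  nlinarith

theorem prod_range_succ_add (N n : ℕ) :
    (N.factorial : ℝ) * ∏ i ∈ Finset.range n, ((N : ℝ) + 1 + i) = (N + n).factorial := by
  induction n with
  | zero => simp
  | succ n ih =>
    rw [Finset.prod_range_succ, ← mul_assoc, ih, ← add_assoc N, Nat.factorial_succ]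
    push_cast
    ring

open Set in
theorem exists_unit_density {m : ℕ} (hm : 0 < m) {j : ℕ} (hj : j < m) :
    ∃ f : ℝ → ℝ, (∀ t, 0 < f t) ∧ IntegrableOn f (Ioo 0 1) ∧ ∀ k : ℕ,
      ((j + (m + 1) * k + (m + 1)).factorial * (m * k + j + 1).factorial : ℝ) *
          (m : ℝ) ^ m * ∫ t in Ioo (0 : ℝ) 1, t ^ (j + (m + 1) * k) * f t =
        ((j + (m + 1) * k).factorial * (m * k + j + 1 + m).factorial : ℝ) *
          ((m : ℝ) + 1) ^ (m + 1) * (k + 1) *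
          ∫ t in Ioo (0 : ℝ) 1, t ^ (j + (m + 1) * (k + 1)) * f t := by
  have hm' : (m : ℝ) ≠ 0 := by exact_mod_cast hm.ne'
  -- With `N = j + (m+1)k`, the factor of `(N+1)...(N+m+1)` with index `m - j` is `(m+1)(k+1)` and
  -- absorbs `k+1`. The other `m` factors are paired with the `m` factors of the denominator.
  set i₀ : Fin (m + 1) := ⟨m - j, by omega⟩ with hi₀
  -- Chosen so that `n + 1 + (m+1)v`, with `n = N + i₀.succAbove i`, equals `(m+1)/m` times the
  -- denominator factor `mk + j + 2 + i`.
  set v : Fin m → ℝ := fun i => ((j : ℝ) + 2 + i) / m - ((j : ℝ) + 1 + i₀.succAbove i) / (m + 1)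
    with hv
  have hvpos : ∀ i, 0 < v i := beta_parameter_pos hm j i₀
  choose μ hμ hμm using fun i => exists_measure_pow_mul_one_sub_pow_rpow m.succ_ne_zero (hvpos i)
    (i₀.succAbove i : ℕ)
  obtain ⟨η, hη, hηm⟩ : ∃ η : Measure ℝ, IsEquivUnitInterval η ∧
      ∀ N : ℕ, ∫ t, t ^ N ∂η = ∏ i, ∫ t, t ^ N ∂(μ i) := by
    obtain ⟨s, rfl⟩ := Nat.exists_eq_succ_of_ne_zero hm.ne'
    exact exists_measure_prod_moments s μ hμ
  obtain ⟨f, hfpos, hfint, hfm⟩ := hη.exists_density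
  refine ⟨f, hfpos, hfint, fun k => ?_⟩
  rw [hfm, hfm, hηm, hηm]
  have hrec : ∀ i, ((j + (m + 1) * k : ℕ) + 1 + (i₀.succAbove i : ℕ) : ℝ) *
      ∫ t, t ^ (j + (m + 1) * k) ∂(μ i) =
      (((m : ℝ) + 1) / m * ((m * k + j + 1 : ℕ) + 1 + (i : ℕ))) *
        ∫ t, t ^ (j + (m + 1) * (k + 1)) ∂(μ i) := by
    intro i
    have h := integral_pow_mul_one_sub_pow_rpow m.succ_ne_zero (hvpos i)
      (j + (m + 1) * k + (i₀.succAbove i : ℕ))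
    rw [hμm, hμm, show j + (m + 1) * (k + 1) + (i₀.succAbove i : ℕ) =
      j + (m + 1) * k + (i₀.succAbove i : ℕ) + m.succ by rw [Nat.succ_eq_add_one]; ring]
    convert h using 2
    · push_cast
      ring
    · simp only [hv]
      push_cast
      field_simp
      ring
  have hprod : (∏ i : Fin m, ((j + (m + 1) * k : ℕ) + 1 + (i₀.succAbove i : ℕ) : ℝ)) *
      ∏ i, ∫ t, t ^ (j + (m + 1) * k) ∂(μ i) =
      (((m : ℝ) + 1) / m) ^ m * (∏ i : Fin m, ((m * k + j + 1 : ℕ) + 1 + (i : ℕ) : ℝ)) *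
        ∏ i, ∫ t, t ^ (j + (m + 1) * (k + 1)) ∂(μ i) := by
    rw [← Finset.prod_mul_distrib, Finset.prod_congr rfl fun i _ => hrec i,
      Finset.prod_mul_distrib, Finset.prod_mul_distrib, Finset.prod_const, Finset.card_univ,
      Fintype.card_fin]
  have hnum : ((j + (m + 1) * k).factorial : ℝ) * (((m : ℝ) + 1) * (k + 1) *
      ∏ i : Fin m, ((j + (m + 1) * k : ℕ) + 1 + (i₀.succAbove i : ℕ) : ℝ)) =
      (j + (m + 1) * k + (m + 1)).factorial := by
    rw [← prod_range_succ_add (j + (m + 1) * k) (m + 1),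
      ← Fin.prod_univ_eq_prod_range (fun i => ((j + (m + 1) * k : ℕ) : ℝ) + 1 + i),
      Fin.prod_univ_succAbove _ i₀]
    congr 2
    rw [hi₀]
    push_cast [Nat.cast_sub hj.le]
    ring
  have hden : ((m * k + j + 1).factorial : ℝ) *
      ∏ i : Fin m, ((m * k + j + 1 : ℕ) + 1 + (i : ℕ) : ℝ) = (m * k + j + 1 + m).factorial := by
    rw [← prod_range_succ_add (m * k + j + 1) m,
      ← Fin.prod_univ_eq_prod_range (fun i => ((m * k + j + 1 : ℕ) : ℝ) + 1 + i)]
  rw [← hnum, ← hden]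
  rw [div_pow] at hprod
  generalize (∏ i, ∫ t, t ^ (j + (m + 1) * k) ∂(μ i)) = A at *
  generalize (∏ i, ∫ t, t ^ (j + (m + 1) * (k + 1)) ∂(μ i)) = B at *
  generalize (∏ i : Fin m, ((j + (m + 1) * k : ℕ) + 1 + (i₀.succAbove i : ℕ) : ℝ)) = P at *
  generalize (∏ i : Fin m, ((m * k + j + 1 : ℕ) + 1 + (i : ℕ) : ℝ)) = Q at *
  field_simp at hprod
  linear_combination ((j + (m + 1) * k).factorial * ((m : ℝ) + 1) * (k + 1) *
    (m * k + j + 1).factorial) * hprod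

open Set in
theorem setIntegral_pow_mul_comp_div {a : ℝ} (ha : 0 < a) (f : ℝ → ℝ) (N : ℕ) :
    ∫ t in Icc 0 a, t ^ N * f (t / a) = a ^ (N + 1) * ∫ t in Ioo (0 : ℝ) 1, t ^ N * f t := by
  have h := intervalIntegral.integral_comp_div (a := 0) (b := a) (fun s => s ^ N * f s) ha.ne'
  rw [zero_div, div_self ha.ne', intervalIntegral.integral_of_le ha.le,
    intervalIntegral.integral_of_le zero_le_one, integral_Ioc_eq_integral_Ioo (x := (0 : ℝ)) (y := 1),
    ← integral_Icc_eq_integral_Ioc, smul_eq_mul] at h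
  rw [pow_succ, mul_assoc, ← h, ← integral_const_mul]
  refine integral_congr_ae (Filter.Eventually.of_forall fun t => ?_)
  dsimp only
  rw [div_pow]
  field_simp

open Set in
theorem integrableOn_comp_div {a : ℝ} (ha : 0 < a) {f : ℝ → ℝ} (hf : IntegrableOn f (Ioo 0 1)) :
    IntegrableOn (fun t => f (t / a)) (Icc 0 a) := by
  have h := ((intervalIntegrable_iff_integrableOn_Ioo_of_le zero_le_one).2 hf).comp_mul_left
    (c := a⁻¹)
  rw [zero_div, one_div, inv_inv, intervalIntegrable_iff_integrableOn_Icc_of_le ha.le] at h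
  simpa only [div_eq_inv_mul] using h

open Set in
/-- The densities, on the ray of positive reals, of the measures whose moments are the Raney
numbers. -/
theorem exists_ray_density {m : ℕ} (hm : 0 < m) {c : ℝ} (hc : 0 < c) {j : ℕ} (hj : j < m) :
    ∃ w : ℝ → ℝ, (∀ t, 0 < w t) ∧ IntegrableOn w (Icc 0 (radius m c)) ∧ ∀ k : ℕ,
      (m + 1) * ∫ t in Icc 0 (radius m c), t ^ (j + (m + 1) * k) * w t =
        pathWeight m c (j + (m + 1) * k) j := by
  have hm' : (m : ℝ) ≠ 0 := by exact_mod_cast hm.ne'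
  have ha := radius_pos hm hc
  obtain ⟨f, hfpos, hfint, hfm⟩ := exists_unit_density hm hj
  set M : ℕ → ℝ := fun k => ∫ t in Ioo (0 : ℝ) 1, t ^ (j + (m + 1) * k) * f t with hM
  have hM0 : 0 < M 0 := by
    have hint : IntegrableOn (fun t => t ^ (j + (m + 1) * 0) * f t) (Ioo 0 1) := by
      refine hfint.mono' ((by fun_prop : Continuous fun t : ℝ =>
        t ^ (j + (m + 1) * 0)).aestronglyMeasurable.mul hfint.aestronglyMeasurable) ?_
      filter_upwards [ae_restrict_mem measurableSet_Ioo] with t ht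
      rw [norm_mul, norm_pow, Real.norm_of_nonneg ht.1.le, Real.norm_of_nonneg (hfpos t).le]
      exact mul_le_of_le_one_left (hfpos t).le (pow_le_one₀ ht.1.le ht.2.le)
    refine (setIntegral_pos_iff_support_of_nonneg_ae ?_ hint).2 ?_
    · filter_upwards [ae_restrict_mem measurableSet_Ioo] with t ht
      exact mul_nonneg (pow_nonneg ht.1.le _) (hfpos t).le
    · refine lt_of_lt_of_le (b := volume (Ioo (0 : ℝ) 1)) (by simp) (measure_mono fun t ht => ?_)
      exact ⟨(mul_pos (pow_pos ht.1 _) (hfpos t)).ne', ht⟩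
  -- This makes the moment for `k = 0` equal to `1`; the quotients determine the others.
  set K : ℝ := 1 / ((m + 1) * radius m c ^ (j + 1) * M 0) with hK
  have hKpos : 0 < K := by positivity
  refine ⟨fun t => K * f (t / radius m c), fun t => mul_pos hKpos (hfpos _),
    (integrableOn_comp_div ha hfint).const_mul K, fun k => ?_⟩
  have hI : ∀ N : ℕ, ∫ t in Icc 0 (radius m c), t ^ N * (K * f (t / radius m c)) =
      K * (radius m c ^ (N + 1) * ∫ t in Ioo (0 : ℝ) 1, t ^ N * f t) := fun N => by
    rw [← setIntegral_pow_mul_comp_div ha, ← integral_const_mul]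
    congr 1 with t
    ring
  rw [hI, pathWeight_eq m c _ j k rfl]
  change (m + 1) * (K * (_ * M k)) = _
  induction k with
  | zero =>
    have := Nat.factorial_pos j
    simp only [Nat.mul_zero, add_zero, zero_add, Nat.factorial_succ, Nat.factorial_zero, hK]
    push_cast
    field_simp
  | succ k ih =>
    have h := hfm k
    change _ * M k = _ * M (k + 1) at h
    have e1 : j + (m + 1) * (k + 1) + 1 = (j + (m + 1) * k + 1) + (m + 1) := by ring
    have e2 : j + (m + 1) * (k + 1) = j + (m + 1) * k + (m + 1) := by ring
    have e3 : m * (k + 1) + j + 1 = m * k + j + 1 + m := by ring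
    -- The radius is the scale whose power `m+1` converts the moment quotients on the unit interval
    -- into those of `pathWeight`.
    rw [e1, pow_add (radius m c), radius_pow hc, e3, e2, Nat.factorial_succ k, div_pow]
    have f1 := Nat.factorial_pos k
    have f2 := Nat.factorial_pos (m * k + j + 1)
    have f3 := Nat.factorial_pos (m * k + j + 1 + m)
    have f4 := Nat.factorial_pos (j + (m + 1) * k)
    have f5 := Nat.factorial_pos (j + (m + 1) * k + (m + 1))
    generalize (m * k + j + 1).factorial = D at *
    generalize (m * k + j + 1 + m).factorial = D' at *
    generalize (j + (m + 1) * k).factorial = E at *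
    generalize (j + (m + 1) * k + (m + 1)).factorial = E' at *
    generalize M k = A at *
    generalize M (k + 1) = B at *
    generalize radius m c ^ (j + (m + 1) * k + 1) = R at *
    push_cast
    have hB : B = E' * D * m ^ m * A / (E * D' * (m + 1) ^ (m + 1) * (k + 1)) := by
      field_simp
      linear_combination -h
    have hA : (m + 1) * (K * (R * A)) * (k.factorial * D) = c ^ k * (j + 1) * E := by
      rw [ih]
      field_simp
    rw [hB, eq_div_iff (by positivity)]
    have hm2 : (m : ℝ) ^ (m + 1) = m ^ m * m := pow_succ _ _
    rw [hm2]
    field_simp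
    linear_combination c * hA

/-! ### Integration over the star -/

theorem norm_rayPoint (m k : ℕ) (t : ℝ) : ‖rayPoint m k t‖ = |t| := by
  have h : 2 * Real.pi * Complex.I * k / (m + 1) =
      ((2 * Real.pi * k / (m + 1) : ℝ) : ℂ) * Complex.I := by
    push_cast
    ring
  rw [rayPoint, norm_mul, h, Complex.norm_exp_ofReal_mul_I, mul_one, Complex.norm_real,
    Real.norm_eq_abs]

theorem isometry_rayPoint (m k : ℕ) : Isometry (rayPoint m k) := by
  refine Isometry.of_dist_eq fun s t => ?_
  rw [dist_eq_norm, Real.dist_eq, ← norm_rayPoint m k]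
  simp only [rayPoint]
  push_cast
  rw [sub_mul]

theorem measurableEmbedding_rayPoint (m k : ℕ) : MeasurableEmbedding (rayPoint m k) :=
  (isometry_rayPoint m k).isClosedEmbedding.measurableEmbedding

theorem integrable_arcLength_iff {m : ℕ} {c : ℝ} {F : ℂ → ℂ} :
    Integrable F (arcLength m c) ↔
      ∀ k : Fin (m + 1), IntegrableOn (fun t => F (rayPoint m k t)) (Set.Icc 0 (radius m c)) := by
  simp only [arcLength, integrable_finsetSum_measure, Finset.mem_univ, forall_const,
    (measurableEmbedding_rayPoint m _).integrable_map_iff]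
  rfl

theorem integral_arcLength {m : ℕ} {c : ℝ} {F : ℂ → ℂ} (hF : Integrable F (arcLength m c)) :
    ∫ x, F x ∂(arcLength m c) =
      ∑ k : Fin (m + 1), ∫ t in Set.Icc 0 (radius m c), F (rayPoint m k t) := by
  rw [arcLength] at hF ⊢
  rw [integral_finsetSum_measure (integrable_finsetSum_measure.1 hF)]
  exact Finset.sum_congr rfl fun k _ => (measurableEmbedding_rayPoint m k).integral_map F

theorem ae_arcLength_norm_le (m : ℕ) (c : ℝ) : ∀ᵐ x ∂(arcLength m c), ‖x‖ ≤ radius m c := by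
  simp only [arcLength, ae_finsetSum_measure_iff, Finset.mem_univ, forall_const,
    (measurableEmbedding_rayPoint m _).ae_map_iff, norm_rayPoint]
  filter_upwards [ae_restrict_mem measurableSet_Icc] with t ht
  rw [abs_of_nonneg ht.1]
  exact ht.2

theorem integrable_eval_mul {m : ℕ} {c : ℝ} {f : ℂ → ℂ} (hf : Integrable f (arcLength m c))
    (P : ℂ[X]) : Integrable (fun x => P.eval x * f x) (arcLength m c) := by
  obtain ⟨b, hb⟩ := (isCompact_closedBall (0 : ℂ) (radius m c)).exists_bound_of_continuousOn
    P.continuous.continuousOn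
  refine hf.bdd_mul (c := b) P.continuous.aestronglyMeasurable ?_
  filter_upwards [ae_arcLength_norm_le m c] with x hx
  exact hb x (by simpa using hx)

/-- The linear functional on polynomials that is given by a density on the star. -/
noncomputable def momentFunctional {m : ℕ} {c : ℝ} {f : ℂ → ℂ}
    (hf : Integrable f (arcLength m c)) : ℂ[X] →ₗ[ℂ] ℂ where
  toFun P := ∫ x, P.eval x * f x ∂(arcLength m c)
  map_add' P Q := by
    simp only [eval_add, add_mul]
    exact integral_add (integrable_eval_mul hf P) (integrable_eval_mul hf Q)
  map_smul' b P := by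
    simp only [eval_smul, smul_eq_mul, mul_assoc, RingHom.id_apply]
    exact integral_const_mul _ _

theorem momentFunctional_apply {m : ℕ} {c : ℝ} {f : ℂ → ℂ}
    (hf : Integrable f (arcLength m c)) (P : ℂ[X]) :
    momentFunctional hf P = ∫ x, P.eval x * f x ∂(arcLength m c) := rfl

/-- This is a geometric sum in `ζ^(n-j)` for a primitive root of unity `ζ` of order `m+1`. -/
theorem sum_exp_pow_mul_exp_neg (m n j : ℕ) :
    ∑ k : Fin (m + 1), Complex.exp (2 * Real.pi * Complex.I * (k : ℕ) / (m + 1)) ^ n *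
        Complex.exp (-(2 * Real.pi * Complex.I * j * (k : ℕ) / (m + 1))) =
      if j ≡ n [MOD m + 1] then (m : ℂ) + 1 else 0 := by
  have hζ := Complex.isPrimitiveRoot_exp (m + 1) m.succ_ne_zero
  set ζ := Complex.exp (2 * Real.pi * Complex.I / (m + 1 : ℕ)) with hζdef
  have hζ0 : ζ ≠ 0 := Complex.exp_ne_zero _
  set ξ : ℂ := ζ ^ ((n : ℤ) - j) with hξ
  have hterm : ∀ k : ℕ, Complex.exp (2 * Real.pi * Complex.I * k / (m + 1)) ^ n *
      Complex.exp (-(2 * Real.pi * Complex.I * j * k / (m + 1))) = ξ ^ k := by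
    intro k
    rw [hξ, hζdef, ← Complex.exp_int_mul, ← Complex.exp_nat_mul, ← Complex.exp_nat_mul,
      ← Complex.exp_add]
    congr 1
    push_cast
    ring
  have h1 : ξ = 1 ↔ j ≡ n [MOD m + 1] := by
    rw [hξ, hζ.zpow_eq_one_iff_dvd, Nat.modEq_iff_dvd]
  simp only [hterm, Fin.sum_univ_eq_sum_range (fun k => ξ ^ k) (m + 1), ← h1]
  split_ifs with h
  · simp [h]
  · have hpow : ξ ^ (m + 1) = 1 := by
      rw [hξ, ← zpow_natCast, ← zpow_mul, mul_comm, zpow_mul, zpow_natCast, hζ.pow_eq_one, one_zpow]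
    rw [geom_sum_eq h, hpow, sub_self, zero_div]

/-- The moments of a density with the rotational symmetry of the star. -/
theorem integral_pow_mul_of_symmetry {m : ℕ} {c : ℝ} {f : ℂ → ℂ} {j : ℕ}
    (hf : Integrable f (arcLength m c))
    (hsym : ∀ k ≤ m, ∀ t ∈ Set.Ioc 0 (radius m c), f (rayPoint m k t) =
      Complex.exp (-(2 * Real.pi * Complex.I * j * k / (m + 1))) * f t) (n : ℕ) :
    ∫ x, x ^ n * f x ∂(arcLength m c) = (if j ≡ n [MOD m + 1] then (m : ℂ) + 1 else 0) *
      ∫ t in Set.Icc 0 (radius m c), (t : ℂ) ^ n * f t := by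
  have hint : Integrable (fun x => x ^ n * f x) (arcLength m c) := by
    simpa using integrable_eval_mul hf (X ^ n)
  rw [integral_arcLength hint, ← sum_exp_pow_mul_exp_neg, Finset.sum_mul]
  refine Finset.sum_congr rfl fun k _ => ?_
  -- The symmetry is known only for `t > 0`, so the origin is discarded as a null set.
  rw [← integral_const_mul, integral_Icc_eq_integral_Ioc, integral_Icc_eq_integral_Ioc]
  refine setIntegral_congr_fun measurableSet_Ioc fun t ht => ?_
  rw [hsym k (Nat.lt_succ_iff.1 k.2) t ht, rayPoint, mul_pow]
  ring

/-! ### Biorthogonality for an arbitrary weight system -/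

/-- Since `T_n = x^n` for `n ≤ m`, symmetry gives the case `n < j` and normalization the case `n =
j`; orthogonality with `ν = 0` gives `n > j`. -/
theorem IsWeightSystem.integral_typeII {m : ℕ} {c : ℝ} {ρ : ℂ → ℝ} {ρs : ℕ → ℂ → ℂ}
    (h : IsWeightSystem m c ρ ρs) {j : ℕ} (hj : j < m) (n : ℕ) :
    ∫ x, (typeII m c n).eval x * (ρs j x * ρ x) ∂(arcLength m c) = if n = j then 1 else 0 := by
  have hT : ∀ n ≤ m, typeII m c n = X ^ n := by
    intro n
    induction n with
    | zero => intro _; rw [typeII_zero, pow_zero]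
    | succ n ih => intro hn; rw [typeII_succ_of_lt c hn, ih (by omega), pow_succ']
  rcases lt_trichotomy n j with hn | rfl | hn
  · rw [if_neg hn.ne, hT n (by omega)]
    simp only [eval_pow, eval_X]
    rw [integral_pow_mul_of_symmetry (h.integrable j hj) (h.symmetry j hj), if_neg, zero_mul]
    intro hmod
    have := Nat.ModEq.eq_of_lt_of_lt hmod (by omega) (by omega)
    omega
  · rw [if_pos rfl, hT n hj.le]
    simpa using h.normalization n hj
  · rw [if_neg hn.ne']
    simpa using h.orthogonality n j hj 0 (by omega)

theorem typeII_mul_linearForm (m : ℕ) (c : ℝ) (ρ : ℂ → ℝ) (ρs : ℕ → ℂ → ℂ) (n r : ℕ) (x : ℂ) :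
    (typeII m c n).eval x * linearForm m c ρs r x * ρ x =
      ∑ j ∈ Finset.range m, (typeII m c n * typeI m c j r).eval x * (ρs j x * ρ x) := by
  rw [linearForm, Finset.mul_sum, Finset.sum_mul]
  refine Finset.sum_congr rfl fun j _ => ?_
  rw [eval_mul]
  ring

theorem IsWeightSystem.integrable_typeII_mul_linearForm {m : ℕ} {c : ℝ} {ρ : ℂ → ℝ}
    {ρs : ℕ → ℂ → ℂ} (h : IsWeightSystem m c ρ ρs) (n r : ℕ) :
    Integrable (fun x => (typeII m c n).eval x * linearForm m c ρs r x * ρ x)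
      (arcLength m c) := by
  simp only [typeII_mul_linearForm]
  exact integrable_finsetSum _ fun j hj =>
    integrable_eval_mul (h.integrable j (Finset.mem_range.1 hj)) _

theorem IsWeightSystem.integral_typeII_mul_linearForm {m : ℕ} (hm : 0 < m) {c : ℝ} (hc : c ≠ 0)
    {ρ : ℂ → ℝ} {ρs : ℕ → ℂ → ℂ} (h : IsWeightSystem m c ρ ρs) (n r : ℕ) :
    ∫ x, (typeII m c n).eval x * linearForm m c ρs r x * ρ x ∂(arcLength m c) =
      if n = r then 1 else 0 := by
  simp only [typeII_mul_linearForm]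
  rw [integral_finsetSum _ fun j hj => integrable_eval_mul
    (h.integrable j (Finset.mem_range.1 hj)) _]
  rw [← sum_typeII_mul_typeI hm hc
    (fun j => if hj : j < m then momentFunctional (h.integrable j hj) else 0) ?_ n r]
  · refine Finset.sum_congr rfl fun j hj => ?_
    rw [dif_pos (Finset.mem_range.1 hj), momentFunctional_apply]
  · intro j hj n
    rw [dif_pos hj, momentFunctional_apply, h.integral_typeII hj]

/-! ### Construction of a weight system -/

/-- The density on the star that equals `w` on the ray of positive reals and is multiplied by
`exp(-2πij/(m+1))` by the rotation that preserves the star. -/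
noncomputable def starDensity (w : ℝ → ℝ) (j : ℕ) (x : ℂ) : ℂ :=
  w ‖x‖ * (starRingEnd ℂ x / ‖x‖) ^ j

theorem starDensity_ofReal (w : ℝ → ℝ) (j : ℕ) {t : ℝ} (ht : 0 < t) :
    starDensity w j t = w t := by
  have : (t : ℂ) ≠ 0 := by exact_mod_cast ht.ne'
  rw [starDensity, Complex.norm_real, Real.norm_of_nonneg ht.le, Complex.conj_ofReal,
    div_self this, one_pow, mul_one]

theorem starDensity_rayPoint (w : ℝ → ℝ) (m j k : ℕ) {t : ℝ} (ht : 0 < t) :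
    starDensity w j (rayPoint m k t) =
      Complex.exp (-(2 * Real.pi * Complex.I * j * k / (m + 1))) * starDensity w j t := by
  have ht' : (t : ℂ) ≠ 0 := by exact_mod_cast ht.ne'
  rw [starDensity_ofReal w j ht, starDensity, norm_rayPoint, abs_of_pos ht, rayPoint, map_mul,
    Complex.conj_ofReal, mul_div_cancel_left₀ _ ht', ← Complex.exp_conj, ← Complex.exp_nat_mul,
    mul_comm]
  congr 2
  simp [map_ofNat]
  ring

theorem integrable_starDensity {m : ℕ} {c : ℝ} {w : ℝ → ℝ}
    (hw : IntegrableOn w (Set.Icc 0 (radius m c))) (j : ℕ) :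
    Integrable (starDensity w j) (arcLength m c) := by
  refine integrable_arcLength_iff.2 fun k => ?_
  have h : IntegrableOn (fun t => Complex.exp (-(2 * Real.pi * Complex.I * j * (k : ℕ) / (m + 1))) *
      (w t : ℂ)) (Set.Icc 0 (radius m c)) := hw.ofReal.const_mul _
  rw [integrableOn_Icc_iff_integrableOn_Ioc] at h ⊢
  refine h.congr_fun (fun t ht => ?_) measurableSet_Ioc
  dsimp only
  rw [starDensity_rayPoint w m j k ht.1, starDensity_ofReal w j ht.1]

theorem integral_pow_mul_starDensity {m : ℕ} {c : ℝ} {w : ℝ → ℝ} {j : ℕ} (hj : j < m)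
    (hw : IntegrableOn w (Set.Icc 0 (radius m c)))
    (hmom : ∀ k : ℕ, (m + 1) * ∫ t in Set.Icc 0 (radius m c), t ^ (j + (m + 1) * k) * w t =
      pathWeight m c (j + (m + 1) * k) j) (N : ℕ) :
    ∫ x, x ^ N * starDensity w j x ∂(arcLength m c) = pathWeight m c N j := by
  rw [integral_pow_mul_of_symmetry (integrable_starDensity hw j)
    fun k _ t ht => starDensity_rayPoint w m j k ht.1]
  split_ifs with h
  · obtain ⟨k, rfl⟩ : ∃ k, N = j + (m + 1) * k := by
      -- As `j < m + 1`, it is the least natural number in its residue class.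
      have hjN : j ≤ N := by
        have := Nat.mod_eq_of_lt (show j < m + 1 by omega)
        rw [← this, h]
        exact Nat.mod_le _ _
      obtain ⟨k, hk⟩ := (Nat.modEq_iff_dvd' hjN).1 h
      exact ⟨k, by omega⟩
    rw [← hmom]
    push_cast
    congr 1
    rw [← integral_complex_ofReal, integral_Icc_eq_integral_Ioc, integral_Icc_eq_integral_Ioc]
    refine setIntegral_congr_fun measurableSet_Ioc fun t ht => ?_
    rw [starDensity_ofReal w j ht.1]
    push_cast
    rfl
  · rw [zero_mul, pathWeight_eq_zero, Complex.ofReal_zero]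
    rintro k rfl
    exact h (by simp [Nat.ModEq])

theorem integral_eval_mul_starDensity {m : ℕ} {c : ℝ} {w : ℝ → ℝ} {j : ℕ} (hj : j < m)
    (hw : IntegrableOn w (Set.Icc 0 (radius m c)))
    (hmom : ∀ k : ℕ, (m + 1) * ∫ t in Set.Icc 0 (radius m c), t ^ (j + (m + 1) * k) * w t =
      pathWeight m c (j + (m + 1) * k) j) (P : ℂ[X]) :
    ∫ x, P.eval x * starDensity w j x ∂(arcLength m c) = coeffFunctional m c j P := by
  rw [← momentFunctional_apply (integrable_starDensity hw j)]
  congr 1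
  refine Polynomial.lhom_ext' fun N => LinearMap.ext fun b => ?_
  rw [LinearMap.comp_apply, LinearMap.comp_apply, coeffFunctional_monomial, momentFunctional_apply,
    ← integral_pow_mul_starDensity hj hw hmom, ← integral_const_mul]
  simp only [eval_monomial, mul_assoc]

theorem exists_isWeightSystem {m : ℕ} (hm : 0 < m) {c : ℝ} (hc : 0 < c) :
    ∃ (ρ : ℂ → ℝ) (ρs : ℕ → ℂ → ℂ), IsWeightSystem m c ρ ρs := by
  have hw : ∀ j, ∃ w : ℝ → ℝ, j < m → (∀ t, 0 < w t) ∧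
      IntegrableOn w (Set.Icc 0 (radius m c)) ∧ ∀ k : ℕ,
        (m + 1) * ∫ t in Set.Icc 0 (radius m c), t ^ (j + (m + 1) * k) * w t =
          pathWeight m c (j + (m + 1) * k) j := fun j => by
    by_cases hj : j < m
    · obtain ⟨w, h⟩ := exists_ray_density hm hc hj
      exact ⟨w, fun _ => h⟩
    · exact ⟨0, fun h => absurd h hj⟩
  choose w hw using hw
  have hw0 : ∀ x : ℂ, (w 0 ‖x‖ : ℂ) ≠ 0 := fun x => by exact_mod_cast ((hw 0 hm).1 ‖x‖).ne'
  have hmul : ∀ (j : ℕ) (x : ℂ),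
      starDensity (w j) j x / (w 0 ‖x‖ : ℂ) * ((w 0 ‖x‖ : ℝ) : ℂ) = starDensity (w j) j x :=
    fun j x => div_mul_cancel₀ _ (hw0 x)
  -- Dividing by the positive radial function `w 0 ‖x‖` forces `ρ_0 = 1` and leaves the products
  -- `ρ_j ρ` equal to the star densities.
  refine ⟨fun x => w 0 ‖x‖, fun j x => starDensity (w j) j x / (w 0 ‖x‖ : ℂ), ?_, ?_, ?_, ?_, ?_, ?_⟩
  · intro x _
    rw [starDensity, pow_zero, mul_one, div_self (hw0 x)]
  · intro j hj
    simp only [hmul]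
    exact integrable_starDensity (hw j hj).2.1 j
  · intro j _ k _ t ht
    rw [hmul, hmul, starDensity_rayPoint (w j) m j k ht.1]
  · intro j hj
    simp only [hmul]
    refine ⟨fun t ht => ?_, Or.inl fun t ht => ?_⟩
    · dsimp only
      rw [starDensity_ofReal (w j) j ht.1, Complex.ofReal_im]
    · dsimp only
      rw [starDensity_ofReal (w j) j ht.1, Complex.ofReal_re]
      exact ((hw j hj).1 t).le
  · intro n j hj ν hν
    simp only [hmul]
    rw [← coeffFunctional_X_pow_mul_typeII m c n j ν hν,
      ← integral_eval_mul_starDensity hj (hw j hj).2.1 (hw j hj).2.2]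
    simp only [eval_mul, eval_pow, eval_X]
  · intro j hj
    simp only [hmul]
    rw [integral_pow_mul_starDensity hj (hw j hj).2.1 (hw j hj).2.2,
      pathWeight_eq m c j j 0 (by simp)]
    have := Nat.factorial_pos j
    have h : c ^ 0 * ((j : ℝ) + 1) * j.factorial /
        ((Nat.factorial 0) * (m * 0 + j + 1).factorial) = 1 := by
      simp only [Nat.mul_zero, zero_add, Nat.factorial_succ, Nat.factorial_zero]
      push_cast
      field_simp
    rw [h, Complex.ofReal_one]

end StarChebyshev

theorem theorem1p1 (m : ℕ) (hm : 0 < m) (c : ℝ) (hc : 0 < c) :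
    (∃ (ρ : ℂ → ℝ) (ρs : ℕ → ℂ → ℂ), StarChebyshev.IsWeightSystem m c ρ ρs) ∧
    ∀ (ρ : ℂ → ℝ) (ρs : ℕ → ℂ → ℂ), StarChebyshev.IsWeightSystem m c ρ ρs →
      ∀ n r : ℕ,
        Integrable (fun x => (StarChebyshev.typeII m c n).eval x *
          StarChebyshev.linearForm m c ρs r x * ρ x) (StarChebyshev.arcLength m c) ∧
        ∫ x, (StarChebyshev.typeII m c n).eval x *
          StarChebyshev.linearForm m c ρs r x * ρ x ∂(StarChebyshev.arcLength m c) =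
            if n = r then 1 else 0 :=
  ⟨StarChebyshev.exists_isWeightSystem hm hc, fun _ _ h n r =>
    ⟨h.integrable_typeII_mul_linearForm n r, h.integral_typeII_mul_linearForm hm hc.ne' n r⟩⟩
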